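/- Let $\{\rho_k\}_{k=1}^{\infty}$ be a sequence of real numbers. For a real random variable $X$ with $\mathbb{E}|X|<\infty$ and an integer $k\ge 1$, let $R_k(X)=\max_{1\le i\le k}X_i-\min_{1\le i\le k}X_i$, where $X_1,\dots,X_k$ are independent copies of $X$. Let $\Delta$ be the forward difference operator, $\Delta\rho_k=\rho_{k+1}-\rho_k$ and $\Delta^{s+1}=\Delta\Delta^s$. Then there exists a non-degenerate (that is, not almost surely constant) integrable random variable $X$ such that $\mathbb{E}R_k(X)=\rho_k$ for all $k\ge 1$ if and only if the following three conditions are satisfied: (i) $(-1)^{s+1}\Delta^s\rho_k>0$ for all integers $s\ge 1$ and $k\ge 1$; (ii) $\rho_k=o(k)$ as $k\to\infty$; (iii) $\rho_k=\sum_{j=1}^{k}(-1)^j\binom{k}{j}\rho_j$ for all $k\ge 1$. -/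

import Mathlib

open MeasureTheory Filter Asymptotics

/-- `X` is a non-degenerate random variable: it is not almost surely equal to a constant. -/
def IsNondegenerate {Ω : Type*} [MeasurableSpace Ω] (P : Measure Ω) (X : Ω → ℝ) : Prop :=
  ∀ c : ℝ, ¬ (∀ᵐ ω ∂P, X ω = c)

/-- The range `max x_i - min x_i` of a sample `(x_i)` of size `k`, meaningful for `k ≥ 1`. -/
noncomputable def sampleRange {k : ℕ} (x : Fin k → ℝ) : ℝ :=
  (⨆ i, x i) - (⨅ i, x i)

/-- The expected sample range `E R_k(X)`. The `k` iid copies of `X` are the functions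
`ω ↦ X (ω i)`, `i : Fin k`, on the `k`-fold product of the probability space `(Ω, P)`.
If `X` is integrable, then so is the sample range. -/
noncomputable def expectedRange {Ω : Type*} [MeasurableSpace Ω] (P : Measure Ω) (X : Ω → ℝ)
    (k : ℕ) : ℝ :=
  ∫ ω : Fin k → Ω, sampleRange (fun i => X (ω i)) ∂(Measure.pi fun _ => P)

/-- The sequence `ρ_1, ρ_2, …` is the expected ranges sequence of `X`. The value `ρ 0` plays no
role. -/
def IsExpectedRangesSequenceOf {Ω : Type*} [MeasurableSpace Ω] (P : Measure Ω) (X : Ω → ℝ)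
    (ρ : ℕ → ℝ) : Prop :=
  ∀ k : ℕ, 1 ≤ k → expectedRange P X k = ρ k

/-! A level `t` lies in `[min, max)` of a sample exactly when some point is `≤ t` and some point is
`> t`. With `F` the distribution function this has probability `1 - F ^ k - (1 - F) ^ k`, so Tonelli
gives `E R_k = ∫ (1 - F ^ k - (1 - F) ^ k) dt` (`lintegral_sampleRange`). Necessity is read off the
integrand: its differences are, up to sign, `F ^ k (1 - F) ^ s + F ^ s (1 - F) ^ k`, it is bounded
by `1`, and the binomial transform exchanges `F ^ k` with `(1 - F) ^ k`.

For sufficiency it is enough to find a measure `μ` on `(0, 1)` with `ρ k = ∫ (1 - t ^ k - (1 - t) ^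
k) dμ`: its distribution function, evaluated at a uniform variable, is the required `X`. Let `Λ` be
linear on polynomials with `Λ 1 = 0` and `Λ (X ^ k) = ρ k`. By (i), `p ↦ -Λ (X (1 - X) p)` is
nonnegative on every `X ^ a (1 - X) ^ b`, so Hausdorff's moment theorem
(`exists_measure_integral_eq`) represents it by a finite measure `ν` on `[0, 1]`. By (iii), `Λ`
takes the same value on `X ^ k` and `(1 - X) ^ k`, which ties `ν` to `2 ρ`. By (ii), `ν` does not
charge `0` or `1`. Then `dμ = dν / (2 t (1 - t))`. -/

/-! ### Hausdorff moment problem via Bernstein weights -/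

open Polynomial Topology in
theorem bernsteinPolynomial_sum_choose (n j : ℕ) :
    ∑ k ∈ Finset.range (n + 1), (k.choose j : ℝ[X]) * bernsteinPolynomial ℝ n k
      = (n.choose j : ℝ[X]) * X ^ j := by
  rcases lt_or_ge n j with h | h
  · rw [Nat.choose_eq_zero_of_lt h]
    simp only [Nat.cast_zero, zero_mul]
    refine Finset.sum_eq_zero fun k hk => ?_
    rw [Nat.choose_eq_zero_of_lt (by simp at hk; omega)]
    simp
  · obtain ⟨r, rfl⟩ := Nat.exists_eq_add_of_le h
    rw [add_assoc, Finset.sum_range_add, Finset.sum_eq_zero, zero_add]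
    · have := bernsteinPolynomial.sum ℝ r
      calc _ = ∑ l ∈ Finset.range (r + 1),
            ((j + r).choose j : ℝ[X]) * X ^ j * bernsteinPolynomial ℝ r l := by
            refine Finset.sum_congr rfl fun l hl => ?_
            have hl' : l ≤ r := by simp at hl; omega
            -- Trading `C(n,k) C(k,j)` for `C(n,j) C(n-j,k-j)` leaves a partition of unity in degree
            -- `n - j = r`.
            have h2 := Nat.choose_mul (n := j + r) (k := j + l) (s := j) (by omega)
            have h3 : ((j + r).choose (j + l) : ℝ[X]) * ((j + l).choose j : ℝ[X])
                = ((j + r).choose j : ℝ[X]) * (r.choose l : ℝ[X]) := by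
              rw [show j + r - j = r by omega, show j + l - j = l by omega] at h2
              exact_mod_cast h2
            rw [bernsteinPolynomial, bernsteinPolynomial,
              show j + r - (j + l) = r - l by omega, pow_add]
            linear_combination (X ^ j * X ^ l * (1 - X) ^ (r - l)) * h3
        _ = _ := by rw [← Finset.mul_sum, this, mul_one]
    · intro k hk
      rw [Nat.choose_eq_zero_of_lt (by simpa using hk)]
      simp

/-- The mixed power and binomial moments of the Bernstein weights of `L` at the points `k / n`. -/
noncomputable def bernsteinMoment (L : Polynomial ℝ →ₗ[ℝ] ℝ) (j i n : ℕ) : ℝ :=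
  ∑ k ∈ Finset.range (n + 1),
    (k.choose j : ℝ) / (n.choose j : ℝ) * ((k : ℝ) / n) ^ i * L (bernsteinPolynomial ℝ n k)

open Polynomial Topology in
theorem bernsteinMoment_zero (L : ℝ[X] →ₗ[ℝ] ℝ) {j n : ℕ} (h : j ≤ n) :
    bernsteinMoment L j 0 n = L (X ^ j) := by
  have h1 := congrArg L (bernsteinPolynomial_sum_choose n j)
  have hn : (n.choose j : ℝ) ≠ 0 := by exact_mod_cast (Nat.choose_pos h).ne'
  have e : ∀ (m : ℕ) (p : ℝ[X]), L ((m : ℝ[X]) * p) = m * L p := fun m p => by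
    rw [← nsmul_eq_mul, map_nsmul, nsmul_eq_mul]
  simp only [map_sum, e] at h1
  rw [bernsteinMoment, ← mul_right_inj' hn, ← h1, Finset.mul_sum]
  refine Finset.sum_congr rfl fun k _ => ?_
  field_simp

-- Since `k C(k,j) = (j+1) C(k,j+1) + j C(k,j)`, a factor `k / n` is traded for one more unit of
-- `j`, up to an error of order `1 / n`.
open Polynomial Topology in
theorem bernsteinMoment_succ (L : ℝ[X] →ₗ[ℝ] ℝ) {j i n : ℕ} (h : j + 1 ≤ n) :
    bernsteinMoment L j (i + 1) n = (((n : ℝ) - j) / n) * bernsteinMoment L (j + 1) i n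
      + ((j : ℝ) / n) * bernsteinMoment L j i n := by
  simp only [bernsteinMoment, Finset.mul_sum, ← Finset.sum_add_distrib]
  refine Finset.sum_congr rfl fun k _ => ?_
  have hn : (n.choose j : ℝ) ≠ 0 := by exact_mod_cast (Nat.choose_pos (by omega)).ne'
  have hn1 : (n.choose (j + 1) : ℝ) ≠ 0 := by exact_mod_cast (Nat.choose_pos h).ne'
  have hn0 : (n : ℝ) ≠ 0 := by norm_cast; omega
  have key : ∀ m : ℕ, (m.choose (j + 1) : ℝ) * (j + 1) = m.choose j * ((m : ℝ) - j) := by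
    intro m
    rcases lt_or_ge m j with hm | hm
    · simp [Nat.choose_eq_zero_of_lt hm, Nat.choose_eq_zero_of_lt (hm.trans (Nat.lt_succ_self j))]
    · rw [← Nat.cast_sub hm]; exact_mod_cast Nat.choose_succ_right_eq m j
  have k1 := key n
  have k2 := key k
  have hj : (j : ℝ) + 1 ≠ 0 := by positivity
  have q : ((n : ℝ) - j) * ((k.choose (j + 1) : ℝ) / n.choose (j + 1))
      = k.choose j / n.choose j * ((k : ℝ) - j) := by
    field_simp
    apply mul_right_cancel₀ hj
    linear_combination ((n : ℝ) - j) * n.choose j * k2 - k.choose j * ((k : ℝ) - j) * k1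
  rw [pow_succ]
  linear_combination (-((k : ℝ) / n) ^ i * L (bernsteinPolynomial ℝ n k) / n) * q

open Polynomial Topology in
theorem tendsto_bernsteinMoment (L : ℝ[X] →ₗ[ℝ] ℝ) (i j : ℕ) :
    Tendsto (bernsteinMoment L j i) atTop (𝓝 (L (X ^ (i + j)))) := by
  induction i generalizing j with
  | zero =>
    refine tendsto_const_nhds.congr' ?_
    filter_upwards [eventually_ge_atTop j] with n hn
    rw [bernsteinMoment_zero L hn, zero_add]
  | succ i ih =>
    have h0 : Tendsto (fun n : ℕ => (j : ℝ) / n) atTop (𝓝 0) :=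
      tendsto_const_div_atTop_nhds_zero_nat _
    have h1 : Tendsto (fun n : ℕ => ((n : ℝ) - j) / n) atTop (𝓝 1) := by
      have := (tendsto_const_nhds (x := (1 : ℝ))).sub h0
      rw [sub_zero] at this
      refine this.congr' ?_
      filter_upwards [eventually_ge_atTop 1] with n hn
      have : (n : ℝ) ≠ 0 := by norm_cast; omega
      field_simp
    have := (h1.mul (ih (j + 1))).add (h0.mul (ih j))
    rw [one_mul, zero_mul, add_zero, show i + (j + 1) = i + 1 + j by ring] at this
    refine this.congr' ?_
    filter_upwards [eventually_ge_atTop (j + 1)] with n hn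
    rw [bernsteinMoment_succ L hn]

/-- The measure with the Bernstein weights of `L` at the points `k / n`. -/
noncomputable def bernsteinMeasure (L : Polynomial ℝ →ₗ[ℝ] ℝ) (n : ℕ) : Measure unitInterval :=
  ∑ k : Fin (n + 1), ENNReal.ofReal (L (bernsteinPolynomial ℝ n k)) • Measure.dirac (bernstein.z k)

instance (L : Polynomial ℝ →ₗ[ℝ] ℝ) (n : ℕ) : IsFiniteMeasure (bernsteinMeasure L n) := by
  constructor
  simp only [bernsteinMeasure, Measure.finsetSum_apply, Measure.smul_apply]
  refine ENNReal.sum_lt_top.2 fun k _ => ?_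
  simp

open Polynomial in
theorem nonneg_bernsteinPolynomial {L : ℝ[X] →ₗ[ℝ] ℝ}
    (hL : ∀ a b : ℕ, 0 ≤ L (X ^ a * (1 - X) ^ b)) (n k : ℕ) :
    0 ≤ L (bernsteinPolynomial ℝ n k) := by
  rw [bernsteinPolynomial, mul_assoc, ← nsmul_eq_mul, map_nsmul]
  exact nsmul_nonneg (hL _ _) _

open Polynomial in
theorem integral_bernsteinMeasure {L : ℝ[X] →ₗ[ℝ] ℝ}
    (hL : ∀ a b : ℕ, 0 ≤ L (X ^ a * (1 - X) ^ b)) (n i : ℕ) :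
    ∫ t, (t : ℝ) ^ i ∂(bernsteinMeasure L n) = bernsteinMoment L 0 i n := by
  rw [bernsteinMeasure, integral_finsetSum_measure]
  · rw [bernsteinMoment, Finset.sum_range]
    refine Finset.sum_congr rfl fun k _ => ?_
    rw [integral_smul_measure, integral_dirac,
      ENNReal.toReal_ofReal (nonneg_bernsteinPolynomial hL n k)]
    simp [bernstein.z, mul_comm]
  · intro k _
    exact (integrable_dirac (by simp)).smul_measure (by simp)

-- The Bernstein measures have mass `L 1` and moments tending to those of `L`; compactness of `[0,
-- 1]` supplies a weak limit, which has exactly these moments.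
open Polynomial Topology in
theorem exists_measure_integral_eq {L : ℝ[X] →ₗ[ℝ] ℝ}
    (hL : ∀ a b : ℕ, 0 ≤ L (X ^ a * (1 - X) ^ b)) :
    ∃ ν : Measure ℝ, IsFiniteMeasure ν ∧ (∀ᵐ t ∂ν, t ∈ Set.Icc (0 : ℝ) 1) ∧
      ∀ p : ℝ[X], ∫ t, p.eval t ∂ν = L p := by
  let m : ℕ → FiniteMeasure unitInterval := fun n => ⟨bernsteinMeasure L n, inferInstance⟩
  have hm : ∀ n, (m n).mass ≤ (L 1).toNNReal := by
    intro n
    have h0 := integral_bernsteinMeasure hL n 0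
    rw [bernsteinMoment_zero L (Nat.zero_le n)] at h0
    simp only [pow_zero, integral_const, smul_eq_mul, mul_one] at h0
    rw [← h0]
    refine le_of_eq ?_
    apply NNReal.coe_injective
    rw [Real.coe_toNNReal _ measureReal_nonneg]
    rfl
  have hc := isCompact_setOfPred_finiteMeasure_le_of_compactSpace unitInterval (L 1).toNNReal
  -- A limit along a nonprincipal ultrafilter plays the role of a convergent subsequence.
  obtain ⟨ν, -, hν⟩ := isCompact_iff_ultrafilter_le_nhds.1 hc ((hyperfilter ℕ).map m)
    (le_principal_iff.2 (Filter.mem_map.2 (Filter.univ_mem' hm)))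
  have hν' : Tendsto m (hyperfilter ℕ) (𝓝 ν) := hν
  have hle : ((hyperfilter ℕ : Ultrafilter ℕ) : Filter ℕ) ≤ atTop := Nat.hyperfilter_le_atTop
  have hmono : ∀ i : ℕ, ∫ t, (t : ℝ) ^ i ∂(ν : Measure unitInterval) = L (X ^ i) := by
    intro i
    have h1 := (FiniteMeasure.tendsto_iff_forall_integral_tendsto.1 hν')
      (BoundedContinuousFunction.mkOfCompact ⟨fun t : unitInterval => (t : ℝ) ^ i, by fun_prop⟩)
    have h2 := (tendsto_bernsteinMoment L i 0).mono_left hle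
    refine tendsto_nhds_unique h1 (h2.congr fun n => ?_)
    rw [← integral_bernsteinMeasure hL n i]
    rfl
  refine ⟨(ν : Measure unitInterval).map Subtype.val, inferInstance, ?_, fun p => ?_⟩
  · refine (ae_map_iff (p := fun t => t ∈ Set.Icc (0 : ℝ) 1)
      measurable_subtype_coe.aemeasurable measurableSet_Icc).2 ?_
    exact Eventually.of_forall fun t => t.2
  · rw [integral_map measurable_subtype_coe.aemeasurable (by fun_prop)]
    simp only [Polynomial.eval_eq_sum_range]
    rw [integral_finsetSum]
    · conv_rhs => rw [p.as_sum_range_C_mul_X_pow]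
      rw [map_sum]
      refine Finset.sum_congr rfl fun i _ => ?_
      rw [integral_const_mul, hmono, ← smul_eq_C_mul, map_smul, smul_eq_mul]
    · intro i _
      refine Integrable.const_mul ?_ _
      exact (BoundedContinuousFunction.mkOfCompact
        ⟨fun t : unitInterval => (t : ℝ) ^ i, by fun_prop⟩).integrable _

/-! ### Levels straddled by a sample -/

/-- The probability that a sample of size `k` has points on both sides of a level below which
each point lies with probability `p`. -/
noncomputable def straddleProb (k : ℕ) (p : ℝ) : ℝ := 1 - p ^ k - (1 - p) ^ k

/-- The half-open form matters: the measure later placed on levels may have atoms. -/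
theorem preimage_straddle_eq_Ico {Ω : Type*} (U : Ω → ℝ) {k : ℕ} (hk : 1 ≤ k) (ω : Fin k → Ω) :
    {t : ℝ | (∃ i, U (ω i) ≤ t) ∧ ∃ j, t < U (ω j)}
      = Set.Ico (⨅ i, U (ω i)) (⨆ i, U (ω i)) := by
  have : Nonempty (Fin k) := ⟨⟨0, hk⟩⟩
  ext t
  simp only [Set.mem_ofPred_eq, Set.mem_Ico]
  refine and_congr ⟨?_, ?_⟩ ?_
  · rintro ⟨i, hi⟩
    exact (ciInf_le (Set.finite_range _).bddBelow i).trans hi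
  · intro h
    obtain ⟨i, hi⟩ := exists_eq_ciInf_of_finite (f := fun i => U (ω i))
    exact ⟨i, hi.trans_le h⟩
  · exact (lt_ciSup_iff (Set.finite_range _).bddAbove).symm

/-- The complement is the union of two product events, all points `≤ t` or all points `> t`,
disjoint because the sample is nonempty. -/
theorem pi_straddle {Ω : Type*} [MeasurableSpace Ω] (P : Measure Ω) [IsProbabilityMeasure P]
    {U : Ω → ℝ} (hU : Measurable U) {k : ℕ} (hk : 1 ≤ k) (t : ℝ) :
    (Measure.pi fun _ : Fin k => P) {ω | (∃ i, U (ω i) ≤ t) ∧ ∃ j, t < U (ω j)}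
      = ENNReal.ofReal (straddleProb k (P.real {ω | U ω ≤ t})) := by
  have hA : MeasurableSet {ω | U ω ≤ t} := measurableSet_le hU measurable_const
  have hB : MeasurableSet {ω | t < U ω} := measurableSet_lt measurable_const hU
  have hset : {ω : Fin k → Ω | (∃ i, U (ω i) ≤ t) ∧ ∃ j, t < U (ω j)}
      = ((Set.univ.pi fun _ => {ω | U ω ≤ t}) ∪ (Set.univ.pi fun _ => {ω | t < U ω}))ᶜ := by
    ext ω
    simp only [Set.mem_ofPred_eq, Set.mem_compl_iff, Set.mem_union, Set.mem_pi, Set.mem_univ,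
      true_imp_iff, not_or, not_forall, not_lt, not_le]
    exact and_comm
  have hd : Disjoint (Set.univ.pi fun _ : Fin k => {ω | U ω ≤ t})
      (Set.univ.pi fun _ : Fin k => {ω | t < U ω}) := by
    rw [Set.disjoint_left]
    intro ω h1 h2
    have h3 : U (ω ⟨0, hk⟩) ≤ t := h1 ⟨0, hk⟩ trivial
    exact h3.not_gt (h2 ⟨0, hk⟩ trivial)
  have hmA : MeasurableSet (Set.univ.pi fun _ : Fin k => {ω | U ω ≤ t}) :=
    MeasurableSet.univ_pi fun _ => hA
  have hmB : MeasurableSet (Set.univ.pi fun _ : Fin k => {ω | t < U ω}) :=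
    MeasurableSet.univ_pi fun _ => hB
  have hpi : ∀ s : Set Ω, (Measure.pi fun _ : Fin k => P).real (Set.univ.pi fun _ => s)
      = P.real s ^ k := by
    intro s
    simp [measureReal_def, Measure.pi_pi]
  have hc : P.real {ω | t < U ω} = 1 - P.real {ω | U ω ≤ t} := by
    rw [← probReal_compl_eq_one_sub hA]
    congr 1
    ext ω
    simp
  rw [hset, ← ofReal_measureReal, probReal_compl_eq_one_sub (hmA.union hmB),
    measureReal_union hd hmB, hpi, hpi, hc, straddleProb, sub_sub]

/-- Tonelli's theorem for the measure of the interval spanned by a sample. -/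
theorem lintegral_pi_measure_Ico {Ω : Type*} [MeasurableSpace Ω] (P : Measure Ω)
    [IsProbabilityMeasure P] {U : Ω → ℝ} (hU : Measurable U) (μ : Measure ℝ) [SFinite μ]
    {k : ℕ} (hk : 1 ≤ k) :
    ∫⁻ ω : Fin k → Ω, μ (Set.Ico (⨅ i, U (ω i)) (⨆ i, U (ω i))) ∂(Measure.pi fun _ => P)
      = ∫⁻ t, ENNReal.ofReal (straddleProb k (P.real {ω | U ω ≤ t})) ∂μ := by
  let S : Set ((Fin k → Ω) × ℝ) :=
    {q | (∃ i, U (q.1 i) ≤ q.2) ∧ ∃ j, q.2 < U (q.1 j)}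
  have hS : MeasurableSet S := by
    have h1 : MeasurableSet {q : (Fin k → Ω) × ℝ | ∃ i, U (q.1 i) ≤ q.2} := by
      simp only [Set.ofPred_exists]
      exact MeasurableSet.iUnion fun i => measurableSet_le (by fun_prop) (by fun_prop)
    have h2 : MeasurableSet {q : (Fin k → Ω) × ℝ | ∃ i, q.2 < U (q.1 i)} := by
      simp only [Set.ofPred_exists]
      exact MeasurableSet.iUnion fun i => measurableSet_lt (by fun_prop) (by fun_prop)
    exact h1.inter h2
  have e1 := Measure.prod_apply (μ := Measure.pi fun _ : Fin k => P) (ν := μ) hS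
  rw [Measure.prod_apply_symm hS] at e1
  calc _ = ∫⁻ ω : Fin k → Ω, μ (Prod.mk ω ⁻¹' S) ∂(Measure.pi fun _ => P) :=
        lintegral_congr fun ω => by rw [← preimage_straddle_eq_Ico U hk]; rfl
    _ = _ := e1.symm
    _ = _ := lintegral_congr fun t => by rw [← pi_straddle P hU hk]; rfl

/-! ### Samples of size two detect integrability and degeneracy -/

theorem sampleRange_nonneg {k : ℕ} (hk : 1 ≤ k) (x : Fin k → ℝ) : 0 ≤ sampleRange x :=
  sub_nonneg.2 (by
    have : Nonempty (Fin k) := ⟨⟨0, hk⟩⟩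
    exact ciInf_le_ciSup (Set.finite_range _).bddBelow (Set.finite_range _).bddAbove)

theorem measurable_sampleRange {Ω : Type*} [MeasurableSpace Ω] {X : Ω → ℝ} (hX : Measurable X)
    (k : ℕ) : Measurable fun ω : Fin k → Ω => sampleRange fun i => X (ω i) := by
  unfold sampleRange
  exact (Measurable.iSup fun i => by fun_prop).sub (Measurable.iInf fun i => by fun_prop)

theorem expectedRange_eq_toReal {Ω : Type*} [MeasurableSpace Ω] (P : Measure Ω) {X : Ω → ℝ}
    (hX : Measurable X) {k : ℕ} (hk : 1 ≤ k) :
    expectedRange P X k = (∫⁻ ω : Fin k → Ω, ENNReal.ofReal (sampleRange fun i => X (ω i))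
      ∂(Measure.pi fun _ => P)).toReal := by
  rw [expectedRange, integral_eq_lintegral_of_nonneg_ae]
  · exact Eventually.of_forall fun ω => sampleRange_nonneg hk _
  · exact (measurable_sampleRange hX k).aestronglyMeasurable

theorem sampleRange_two (x : Fin 2 → ℝ) : sampleRange x = |x 0 - x 1| := by
  have h1 : (⨆ i, x i) = max (x 0) (x 1) := by
    refine le_antisymm (ciSup_le fun i => ?_) (max_le ?_ ?_)
    · fin_cases i <;> simp
    · exact le_ciSup (Set.finite_range x).bddAbove 0
    · exact le_ciSup (Set.finite_range x).bddAbove 1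
  have h2 : (⨅ i, x i) = min (x 0) (x 1) := by
    refine le_antisymm (le_min ?_ ?_) (le_ciInf fun i => ?_)
    · exact ciInf_le (Set.finite_range x).bddBelow 0
    · exact ciInf_le (Set.finite_range x).bddBelow 1
    · fin_cases i <;> simp
  rw [sampleRange, h1, h2, max_sub_min_eq_abs']

theorem lintegral_sampleRange_two {Ω : Type*} [MeasurableSpace Ω] (P : Measure Ω)
    [IsProbabilityMeasure P] {X : Ω → ℝ} (hX : Measurable X) :
    ∫⁻ ω : Fin 2 → Ω, ENNReal.ofReal (sampleRange fun i => X (ω i)) ∂(Measure.pi fun _ => P)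
      = ∫⁻ q, ENNReal.ofReal |X q.1 - X q.2| ∂(P.prod P) := by
  rw [← (measurePreserving_finTwoArrow P).lintegral_comp (by fun_prop)]
  refine lintegral_congr fun ω => ?_
  rw [sampleRange_two]
  rfl

/-- By Fubini some section `x ↦ X x - X ω` is integrable, and adding back the constant `X ω`
recovers `X`. -/
theorem integrable_prod_sub_iff {Ω : Type*} [MeasurableSpace Ω] (P : Measure Ω)
    [IsProbabilityMeasure P] {X : Ω → ℝ} :
    Integrable (fun q : Ω × Ω => X q.1 - X q.2) (P.prod P) ↔ Integrable X P := by
  refine ⟨fun h => ?_, fun h => (h.comp_fst P).sub (h.comp_snd P)⟩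
  obtain ⟨ω, hω⟩ := h.prod_left_ae.exists
  exact (hω.add (integrable_const (X ω))).congr (Eventually.of_forall fun x => by simp)

theorem lintegral_sampleRange_two_lt_top_iff {Ω : Type*} [MeasurableSpace Ω] (P : Measure Ω)
    [IsProbabilityMeasure P] {X : Ω → ℝ} (hX : Measurable X) :
    ∫⁻ ω : Fin 2 → Ω, ENNReal.ofReal (sampleRange fun i => X (ω i)) ∂(Measure.pi fun _ => P) < ⊤
      ↔ Integrable X P := by
  rw [lintegral_sampleRange_two P hX, ← integrable_prod_sub_iff P]
  have hm : AEStronglyMeasurable (fun q : Ω × Ω => X q.1 - X q.2) (P.prod P) := by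
    have : Measurable (fun q : Ω × Ω => X q.1 - X q.2) := by fun_prop
    exact this.aestronglyMeasurable
  rw [Integrable, and_iff_right hm, hasFiniteIntegral_iff_norm]
  rfl

theorem lintegral_sampleRange_two_eq_zero_iff {Ω : Type*} [MeasurableSpace Ω] (P : Measure Ω)
    [IsProbabilityMeasure P] {X : Ω → ℝ} (hX : Measurable X) :
    ∫⁻ ω : Fin 2 → Ω, ENNReal.ofReal (sampleRange fun i => X (ω i)) ∂(Measure.pi fun _ => P) = 0
      ↔ ¬ IsNondegenerate P X := by
  rw [lintegral_sampleRange_two P hX, lintegral_eq_zero_iff (by fun_prop)]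
  simp only [IsNondegenerate, not_forall, not_not]
  constructor
  · intro h
    obtain ⟨ω, hω⟩ := (Measure.ae_ae_of_ae_prod h).exists
    refine ⟨X ω, hω.mono fun ω' h' => ?_⟩
    have : X ω - X ω' = 0 := by simpa using h'
    linarith
  · rintro ⟨c, hc⟩
    have h1 := (Measure.quasiMeasurePreserving_fst (μ := P) (ν := P)).ae hc
    have h2 := (Measure.quasiMeasurePreserving_snd (μ := P) (ν := P)).ae hc
    filter_upwards [h1, h2] with q hq1 hq2
    simp [hq1, hq2]

/-! ### Bounds and identities for the straddling probability -/

theorem straddleProb_two (p : ℝ) : straddleProb 2 p = 2 * (p * (1 - p)) := by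
  rw [straddleProb]; ring

theorem continuous_straddleProb (k : ℕ) : Continuous (straddleProb k) := by
  unfold straddleProb; fun_prop

theorem straddleProb_succ_sub (k : ℕ) (p : ℝ) :
    straddleProb (k + 1) p - straddleProb k p = p ^ k * (1 - p) + (1 - p) ^ k * p := by
  simp only [straddleProb]; ring

theorem pow_mul_one_sub_pow_le {p : ℝ} (hp : p ∈ Set.Icc (0 : ℝ) 1) {a b : ℕ} (ha : 1 ≤ a)
    (hb : 1 ≤ b) : p ^ a * (1 - p) ^ b ≤ p * (1 - p) := by
  obtain ⟨h0, h1⟩ := hp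
  exact mul_le_mul (pow_le_of_le_one h0 h1 (by omega))
    (pow_le_of_le_one (by linarith) (by linarith) (by omega)) (by positivity [sub_nonneg.2 h1]) h0

theorem straddleProb_nonneg {p : ℝ} (hp : p ∈ Set.Icc (0 : ℝ) 1) {k : ℕ} (hk : 1 ≤ k) :
    0 ≤ straddleProb k p := by
  obtain ⟨h0, h1⟩ := hp
  have a := pow_le_of_le_one h0 h1 (n := k) (by omega)
  have b := pow_le_of_le_one (sub_nonneg.2 h1) (by linarith) (n := k) (by omega)
  rw [straddleProb]
  linarith

theorem straddleProb_le_one {p : ℝ} (hp : p ∈ Set.Icc (0 : ℝ) 1) (k : ℕ) :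
    straddleProb k p ≤ 1 := by
  have a := pow_nonneg hp.1 k
  have b := pow_nonneg (sub_nonneg.2 hp.2) k
  rw [straddleProb]
  linarith

/-- Each increment in `k` is at most `2 p (1 - p)`. This makes the case `k = 2` a dominating
function for all the integrals below. -/
theorem straddleProb_le_mul {p : ℝ} (hp : p ∈ Set.Icc (0 : ℝ) 1) {k : ℕ} (hk : 1 ≤ k) :
    straddleProb k p ≤ k * straddleProb 2 p := by
  induction k, hk using Nat.le_induction with
  | base =>
    rw [straddleProb_two, straddleProb]
    have := mul_nonneg hp.1 (sub_nonneg.2 hp.2)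
    simp
    linarith
  | succ k hk ih =>
    have h := straddleProb_succ_sub k p
    have a := pow_mul_one_sub_pow_le hp hk le_rfl
    have b := pow_mul_one_sub_pow_le hp le_rfl hk
    rw [straddleProb_two] at ih ⊢
    push_cast
    simp only [pow_one] at a b
    linarith

/-- For `k ≥ 1` the binomial transform fixes the sequence `straddleProb · p`. -/
theorem sum_straddleProb {k : ℕ} (hk : 1 ≤ k) (p : ℝ) :
    ∑ j ∈ Finset.Icc 1 k, (-1 : ℝ) ^ j * (k.choose j : ℝ) * straddleProb j p
      = straddleProb k p := by
  have bin : ∀ x : ℝ, ∑ j ∈ Finset.range (k + 1), (-1 : ℝ) ^ j * (k.choose j : ℝ) * x ^ j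
      = (1 - x) ^ k := by
    intro x
    rw [sub_eq_neg_add, add_pow]
    refine Finset.sum_congr rfl fun j _ => ?_
    rw [neg_pow x]
    simp
    ring
  have hs : ∑ j ∈ Finset.range (k + 1), (-1 : ℝ) ^ j * (k.choose j : ℝ) * straddleProb j p
      = (1 - 1) ^ k - (1 - p) ^ k - (1 - (1 - p)) ^ k := by
    rw [← bin 1, ← bin p, ← bin (1 - p), ← Finset.sum_sub_distrib, ← Finset.sum_sub_distrib]
    refine Finset.sum_congr rfl fun j _ => ?_
    rw [straddleProb]
    ring
  -- The term `j = 0` is `straddleProb 0 p = -1`; splitting it off restores the `1` lost when the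
  -- constant sequence is sent to `0 ^ k = 0`.
  rw [Finset.range_eq_Ico, Finset.sum_eq_sum_Ico_succ_bot (by omega), sub_self,
    zero_pow (by omega)] at hs
  have e : Finset.Icc 1 k = Finset.Ico (0 + 1) (k + 1) := by ext; simp
  rw [e]
  simp [straddleProb] at hs ⊢
  linarith

/-! ### The three conditions for integrals of straddling probabilities -/

theorem integrable_comp_of_le_straddleProb {μ : Measure ℝ} {G : ℝ → ℝ} (hG : Measurable G)
    (h01 : ∀ t, G t ∈ Set.Icc (0 : ℝ) 1) (hint : Integrable (fun t => straddleProb 2 (G t)) μ)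
    {c : ℝ → ℝ} (hc : Continuous c) (C : ℝ)
    (hb : ∀ p ∈ Set.Icc (0 : ℝ) 1, |c p| ≤ C * straddleProb 2 p) :
    Integrable (fun t => c (G t)) μ :=
  (hint.const_mul C).mono' (hc.measurable.comp hG).aestronglyMeasurable
    (Eventually.of_forall fun t => hb _ (h01 t))

theorem integrable_straddleProb {μ : Measure ℝ} {G : ℝ → ℝ} (hG : Measurable G)
    (h01 : ∀ t, G t ∈ Set.Icc (0 : ℝ) 1) (hint : Integrable (fun t => straddleProb 2 (G t)) μ)
    {k : ℕ} (hk : 1 ≤ k) : Integrable (fun t => straddleProb k (G t)) μ :=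
  integrable_comp_of_le_straddleProb hG h01 hint (continuous_straddleProb k) k fun p hp => by
    rw [abs_of_nonneg (straddleProb_nonneg hp hk)]
    exact straddleProb_le_mul hp hk

theorem integrable_pow_mul_one_sub_pow {μ : Measure ℝ} {G : ℝ → ℝ} (hG : Measurable G)
    (h01 : ∀ t, G t ∈ Set.Icc (0 : ℝ) 1) (hint : Integrable (fun t => straddleProb 2 (G t)) μ)
    {a b : ℕ} (ha : 1 ≤ a) (hb : 1 ≤ b) : Integrable (fun t => G t ^ a * (1 - G t) ^ b) μ :=
  integrable_comp_of_le_straddleProb hG h01 hint (c := fun p => p ^ a * (1 - p) ^ b)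
    (by fun_prop) 1 fun p hp => by
    have h1 := sub_nonneg.2 hp.2
    have h0 := hp.1
    rw [abs_of_nonneg (by positivity), straddleProb_two, one_mul]
    have := mul_nonneg h0 h1
    linarith [pow_mul_one_sub_pow_le hp ha hb]

/-- Each further difference in `k` multiplies `G ^ k` by `-(1 - G)` and `(1 - G) ^ k` by `-G`. -/
theorem fwdDiff_integral_straddleProb {μ : Measure ℝ} {G : ℝ → ℝ} (hG : Measurable G)
    (h01 : ∀ t, G t ∈ Set.Icc (0 : ℝ) 1) (hint : Integrable (fun t => straddleProb 2 (G t)) μ)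
    {ρ : ℕ → ℝ} (hρ : ∀ k, 1 ≤ k → ρ k = ∫ t, straddleProb k (G t) ∂μ) (s : ℕ) {k : ℕ}
    (hk : 1 ≤ k) :
    (-1 : ℝ) ^ s * (fwdDiff 1)^[s + 1] ρ k = ∫ t, (G t ^ k * (1 - G t) ^ (s + 1) +
      G t ^ (s + 1) * (1 - G t) ^ k) ∂μ := by
  induction s generalizing k with
  | zero =>
    simp only [zero_add, Function.iterate_one, fwdDiff, pow_zero, one_mul, pow_one]
    rw [hρ k hk, hρ (k + 1) (by omega), ← integral_sub
      (integrable_straddleProb hG h01 hint (by omega)) (integrable_straddleProb hG h01 hint hk)]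
    refine integral_congr_ae (Eventually.of_forall fun t => ?_)
    simp only [straddleProb_succ_sub]
    ring
  | succ s ih =>
    have i1 : ∀ m, 1 ≤ m → Integrable (fun t => G t ^ m * (1 - G t) ^ (s + 1) +
        G t ^ (s + 1) * (1 - G t) ^ m) μ := fun m hm =>
      (integrable_pow_mul_one_sub_pow hG h01 hint hm (by omega)).add
        (integrable_pow_mul_one_sub_pow hG h01 hint (by omega) hm)
    rw [Function.iterate_succ_apply', fwdDiff]
    have : (-1 : ℝ) ^ (s + 1) * ((fwdDiff 1)^[s + 1] ρ (k + 1) - (fwdDiff 1)^[s + 1] ρ k)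
        = (-1 : ℝ) ^ s * (fwdDiff 1)^[s + 1] ρ k
          - (-1 : ℝ) ^ s * (fwdDiff 1)^[s + 1] ρ (k + 1) := by ring
    rw [this, ih hk, ih (by omega), ← integral_sub (i1 k hk) (i1 (k + 1) (by omega))]
    refine integral_congr_ae (Eventually.of_forall fun t => ?_)
    ring

/-- The integrand is nonnegative, and a zero integral would force `G ∈ {0, 1}` almost everywhere,
hence `ρ 2 = 0`. -/
theorem fwdDiff_integral_straddleProb_pos {μ : Measure ℝ} {G : ℝ → ℝ} (hG : Measurable G)
    (h01 : ∀ t, G t ∈ Set.Icc (0 : ℝ) 1) (hint : Integrable (fun t => straddleProb 2 (G t)) μ)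
    {ρ : ℕ → ℝ} (hρ : ∀ k, 1 ≤ k → ρ k = ∫ t, straddleProb k (G t) ∂μ) (h2 : ρ 2 ≠ 0)
    {s k : ℕ} (hs : 1 ≤ s) (hk : 1 ≤ k) : 0 < (-1 : ℝ) ^ (s + 1) * (fwdDiff 1)^[s] ρ k := by
  obtain ⟨s, rfl⟩ := Nat.exists_eq_add_of_le' hs
  rw [show s + 1 + 1 = s + 2 by ring, pow_add, neg_one_sq, mul_one,
    fwdDiff_integral_straddleProb hG h01 hint hρ s hk]
  have hn : ∀ t, 0 ≤ G t ^ k * (1 - G t) ^ (s + 1) ∧ 0 ≤ G t ^ (s + 1) * (1 - G t) ^ k := by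
    intro t
    have h0 := (h01 t).1
    have h1 := sub_nonneg.2 (h01 t).2
    constructor <;> positivity
  refine lt_of_le_of_ne (integral_nonneg fun t => add_nonneg (hn t).1 (hn t).2) fun h => h2 ?_
  have hz := (integral_eq_zero_iff_of_nonneg (fun t => add_nonneg (hn t).1 (hn t).2)
    ((integrable_pow_mul_one_sub_pow hG h01 hint hk (by omega)).add
        (integrable_pow_mul_one_sub_pow hG h01 hint (by omega) hk))).1 h.symm
  rw [hρ 2 (by omega)]
  refine integral_eq_zero_of_ae (hz.mono fun t ht => ?_)
  have ht' : G t ^ k * (1 - G t) ^ (s + 1) = 0 := by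
    have : G t ^ k * (1 - G t) ^ (s + 1) + G t ^ (s + 1) * (1 - G t) ^ k = 0 := ht
    linarith [(hn t).1, (hn t).2]
  simp only [straddleProb_two, Pi.zero_apply]
  rcases mul_eq_zero.1 ht' with h | h
  · rw [pow_eq_zero_iff (by omega)] at h
    simp [h]
  · rw [pow_eq_zero_iff (by omega)] at h
    simp [h]

-- Dominated convergence: the integrand over `k` is at most `1 / k` pointwise and is dominated by
-- the case `k = 2`.
open Topology in
theorem integral_straddleProb_isLittleO {μ : Measure ℝ} {G : ℝ → ℝ} (hG : Measurable G)
    (h01 : ∀ t, G t ∈ Set.Icc (0 : ℝ) 1) (hint : Integrable (fun t => straddleProb 2 (G t)) μ)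
    {ρ : ℕ → ℝ} (hρ : ∀ k, 1 ≤ k → ρ k = ∫ t, straddleProb k (G t) ∂μ) :
    ρ =o[atTop] fun k : ℕ => (k : ℝ) := by
  have hlim : Tendsto (fun k : ℕ => ∫ t, straddleProb k (G t) / k ∂μ) atTop
      (𝓝 (∫ _, (0 : ℝ) ∂μ)) := by
    refine tendsto_integral_filter_of_dominated_convergence (fun t => straddleProb 2 (G t))
      ?_ ?_ hint ?_
    · exact Eventually.of_forall fun k =>
        (((continuous_straddleProb k).measurable.comp hG).div_const _).aestronglyMeasurable
    · filter_upwards [eventually_ge_atTop 1] with k hk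
      refine Eventually.of_forall fun t => ?_
      have hk' : (0 : ℝ) < k := by exact_mod_cast hk
      rw [Real.norm_of_nonneg (div_nonneg (straddleProb_nonneg (h01 t) hk) hk'.le),
        div_le_iff₀ hk', mul_comm]
      exact straddleProb_le_mul (h01 t) hk
    · refine Eventually.of_forall fun t => ?_
      refine tendsto_of_tendsto_of_tendsto_of_le_of_le' tendsto_const_nhds
        (tendsto_const_div_atTop_nhds_zero_nat 1) ?_ ?_
      · filter_upwards [eventually_ge_atTop 1] with k hk
        exact div_nonneg (straddleProb_nonneg (h01 t) hk) (Nat.cast_nonneg _)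
      · exact Eventually.of_forall fun k =>
          div_le_div_of_nonneg_right (straddleProb_le_one (h01 t) k) (Nat.cast_nonneg _)
  rw [integral_zero] at hlim
  rw [isLittleO_iff_tendsto']
  · refine hlim.congr' ?_
    filter_upwards [eventually_ge_atTop 1] with k hk
    rw [integral_div, hρ k hk]
  · filter_upwards [eventually_ge_atTop 1] with k hk h
    norm_cast at h
    omega

theorem sum_integral_straddleProb {μ : Measure ℝ} {G : ℝ → ℝ} (hG : Measurable G)
    (h01 : ∀ t, G t ∈ Set.Icc (0 : ℝ) 1) (hint : Integrable (fun t => straddleProb 2 (G t)) μ)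
    {ρ : ℕ → ℝ} (hρ : ∀ k, 1 ≤ k → ρ k = ∫ t, straddleProb k (G t) ∂μ) {k : ℕ} (hk : 1 ≤ k) :
    ρ k = ∑ j ∈ Finset.Icc 1 k, (-1 : ℝ) ^ j * (k.choose j : ℝ) * ρ j := by
  have : ∀ j ∈ Finset.Icc 1 k, (-1 : ℝ) ^ j * (k.choose j : ℝ) * ρ j
      = ∫ t, (-1 : ℝ) ^ j * (k.choose j : ℝ) * straddleProb j (G t) ∂μ := fun j hj => by
    rw [hρ j (Finset.mem_Icc.1 hj).1, integral_const_mul]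
  rw [Finset.sum_congr rfl this, ← integral_finsetSum]
  · simp only [sum_straddleProb hk]
    exact hρ k hk
  · exact fun j hj =>
      (integrable_straddleProb hG h01 hint (Finset.mem_Icc.1 hj).1).const_mul _

/-! ### Expected range in terms of the distribution function -/

theorem lintegral_sampleRange {Ω : Type*} [MeasurableSpace Ω] (P : Measure Ω)
    [IsProbabilityMeasure P] {X : Ω → ℝ} (hX : Measurable X) {k : ℕ} (hk : 1 ≤ k) :
    ∫⁻ ω : Fin k → Ω, ENNReal.ofReal (sampleRange fun i => X (ω i)) ∂(Measure.pi fun _ => P)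
      = ∫⁻ t, ENNReal.ofReal (straddleProb k (P.real {ω | X ω ≤ t})) := by
  rw [← lintegral_pi_measure_Ico P hX volume hk]
  simp only [Real.volume_Ico]
  rfl

theorem measurable_measureReal_le {Ω : Type*} [MeasurableSpace Ω] (P : Measure Ω)
    [IsProbabilityMeasure P] (X : Ω → ℝ) : Measurable fun t => P.real {ω | X ω ≤ t} :=
  Monotone.measurable fun _ _ h => measureReal_mono fun _ hω => le_trans hω h

theorem straddleProb_integrable {Ω : Type*} [MeasurableSpace Ω] (P : Measure Ω)
    [IsProbabilityMeasure P] {X : Ω → ℝ} (hX : Measurable X) (hi : Integrable X P) :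
    Integrable fun t => straddleProb 2 (P.real {ω | X ω ≤ t}) := by
  have h := (lintegral_sampleRange_two_lt_top_iff P hX).2 hi
  rw [lintegral_sampleRange P hX (by norm_num)] at h
  refine ⟨((continuous_straddleProb 2).measurable.comp
    (measurable_measureReal_le P X)).aestronglyMeasurable, ?_⟩
  rw [hasFiniteIntegral_iff_ofReal (Eventually.of_forall fun t =>
    straddleProb_nonneg ⟨measureReal_nonneg, measureReal_le_one⟩ (by norm_num))]
  exact h

theorem expectedRange_eq_integral {Ω : Type*} [MeasurableSpace Ω] (P : Measure Ω)
    [IsProbabilityMeasure P] {X : Ω → ℝ} (hX : Measurable X) {k : ℕ} (hk : 1 ≤ k) :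
    expectedRange P X k = ∫ t, straddleProb k (P.real {ω | X ω ≤ t}) := by
  rw [expectedRange_eq_toReal P hX hk, lintegral_sampleRange P hX hk,
    integral_eq_lintegral_of_nonneg_ae]
  · exact Eventually.of_forall fun t =>
      straddleProb_nonneg ⟨measureReal_nonneg, measureReal_le_one⟩ hk
  · exact ((continuous_straddleProb k).measurable.comp
      (measurable_measureReal_le P X)).aestronglyMeasurable

theorem expectedRange_two_ne_zero {Ω : Type*} [MeasurableSpace Ω] (P : Measure Ω)
    [IsProbabilityMeasure P] {X : Ω → ℝ} (hX : Measurable X) (hi : Integrable X P) :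
    expectedRange P X 2 ≠ 0 ↔ IsNondegenerate P X := by
  rw [expectedRange_eq_toReal P hX (by norm_num), not_iff_comm,
    ← lintegral_sampleRange_two_eq_zero_iff P hX, ENNReal.toReal_eq_zero_iff,
    or_iff_left ((lintegral_sampleRange_two_lt_top_iff P hX).2 hi).ne]

/-! ### Realising a measure on levels by a quantile transform -/

/-- The signed `μ`-measure of the interval from `1 / 2` to `u`. -/
noncomputable def centredDistribution (μ : Measure ℝ) (u : ℝ) : ℝ :=
  μ.real (Set.Ico (1 / 2) u) - μ.real (Set.Ico u (1 / 2))

theorem measurable_centredDistribution (μ : Measure ℝ) : Measurable (centredDistribution μ) := by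
  have h1 : Monotone fun u : ℝ => μ (Set.Ico (1 / 2) u) := fun _ _ h =>
    measure_mono (Set.Ico_subset_Ico_right h)
  have h2 : Antitone fun u : ℝ => μ (Set.Ico u (1 / 2)) := fun _ _ h =>
    measure_mono (Set.Ico_subset_Ico_left h)
  exact h1.measurable.ennreal_toReal.sub h2.measurable.ennreal_toReal

/-- The mass of `μ` may be infinite near `0` and `1`, so the distribution function is based at the
interior point `1 / 2` and finiteness is asked only away from the endpoints. -/
theorem centredDistribution_sub {μ : Measure ℝ}
    (hμ : ∀ a b : ℝ, 0 < a → b < 1 → μ (Set.Ico a b) ≠ ⊤) {a b : ℝ} (ha : 0 < a) (hab : a ≤ b)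
    (hb : b < 1) :
    centredDistribution μ b - centredDistribution μ a = μ.real (Set.Ico a b) := by
  have add : ∀ {x y z : ℝ}, 0 < x → x ≤ y → y ≤ z → z < 1 →
      μ.real (Set.Ico x z) = μ.real (Set.Ico x y) + μ.real (Set.Ico y z) := by
    intro x y z hx hxy hyz hz
    rw [← Set.Ico_union_Ico_eq_Ico hxy hyz]
    exact measureReal_union (Set.Ico_disjoint_Ico_same) measurableSet_Ico
      (hμ _ _ hx (hyz.trans_lt hz)) (hμ _ _ (hx.trans_le hxy) hz)
  simp only [centredDistribution]
  rcases le_total a (1 / 2) with h1 | h1 <;> rcases le_total b (1 / 2) with h2 | h2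
  · rw [Set.Ico_eq_empty (not_lt.2 h1), Set.Ico_eq_empty (not_lt.2 h2), add ha hab h2 (by norm_num)]
    simp
  · rw [Set.Ico_eq_empty (not_lt.2 h1), Set.Ico_eq_empty (not_lt.2 h2), add ha h1 h2 hb]
    simp
    ring
  · have : a = b := le_antisymm hab (h2.trans h1)
    simp [this]
  · rw [Set.Ico_eq_empty (not_lt.2 h1), Set.Ico_eq_empty (not_lt.2 h2),
      add (by norm_num) h1 hab hb]
    simp

theorem sampleRange_comp_monotoneOn {s : Set ℝ} {Q : ℝ → ℝ} (hQ : MonotoneOn Q s) {k : ℕ}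
    (hk : 1 ≤ k) {x : Fin k → ℝ} (hx : ∀ i, x i ∈ s) :
    (⨅ i, x i) ∈ s ∧ (⨆ i, x i) ∈ s ∧
      sampleRange (fun i => Q (x i)) = Q (⨆ i, x i) - Q (⨅ i, x i) := by
  have : Nonempty (Fin k) := ⟨⟨0, hk⟩⟩
  obtain ⟨i, hi⟩ := exists_eq_ciInf_of_finite (f := x)
  obtain ⟨j, hj⟩ := exists_eq_ciSup_of_finite (f := x)
  refine ⟨hi ▸ hx i, hj ▸ hx j, ?_⟩
  have hinf : ∀ l, x i ≤ x l := fun l => hi ▸ ciInf_le (Set.finite_range x).bddBelow l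
  have hsup : ∀ l, x l ≤ x j := fun l => hj ▸ le_ciSup (Set.finite_range x).bddAbove l
  rw [sampleRange, ← hi, ← hj]
  congr 1
  · exact le_antisymm (ciSup_le fun l => hQ (hx l) (hx j) (hsup l))
      (le_ciSup (f := fun l => Q (x l)) (Set.finite_range _).bddAbove j)
  · exact le_antisymm (ciInf_le (f := fun l => Q (x l)) (Set.finite_range _).bddBelow i)
      (le_ciInf fun l => hQ (hx i) (hx l) (hinf l))

/-- Markov's inequality, since `2 t (1 - t) ≥ 2 a (1 - b)` on `[a, b)`. -/
theorem measure_Ico_ne_top_of_lintegral_straddleProb {μ : Measure ℝ}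
    (hfin : ∫⁻ t, ENNReal.ofReal (straddleProb 2 t) ∂μ ≠ ⊤) (a b : ℝ) (ha : 0 < a) (hb : b < 1) :
    μ (Set.Ico a b) ≠ ⊤ := by
  have hpos : 0 < 2 * (a * (1 - b)) := by
    have := sub_pos.2 hb
    positivity
  have h := meas_ge_le_lintegral_div (μ := μ) (f := fun t => ENNReal.ofReal (straddleProb 2 t))
    (continuous_straddleProb 2).measurable.ennreal_ofReal.aemeasurable
    (ε := ENNReal.ofReal (2 * (a * (1 - b)))) (by simpa using hpos) ENNReal.ofReal_ne_top
  refine ne_top_of_le_ne_top (ENNReal.div_ne_top hfin (by simpa using hpos))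
    (le_trans (measure_mono fun t ht => ?_) h)
  refine ENNReal.ofReal_le_ofReal ?_
  rw [straddleProb_two]
  have h1 := sub_pos.2 hb
  have := mul_le_mul ht.1 (by linarith [ht.2] : 1 - b ≤ 1 - t) h1.le (ha.le.trans ht.1)
  linarith

/-- The quantile transform of `μ` turns a uniform variable into one whose sample ranges
integrate `straddleProb` against `μ`. -/
theorem lintegral_sampleRange_centredDistribution {Ω : Type*} [MeasurableSpace Ω] (P : Measure Ω)
    [IsProbabilityMeasure P] {U : Ω → ℝ} (hU : Measurable U) (hU01 : ∀ᵐ ω ∂P, U ω ∈ Set.Ioo 0 1)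
    (hunif : ∀ t ∈ Set.Ioo (0 : ℝ) 1, P.real {ω | U ω ≤ t} = t) {μ : Measure ℝ} [SFinite μ]
    (hμ : ∀ᵐ t ∂μ, t ∈ Set.Ioo (0 : ℝ) 1)
    (hfin : ∫⁻ t, ENNReal.ofReal (straddleProb 2 t) ∂μ ≠ ⊤) {k : ℕ} (hk : 1 ≤ k) :
    ∫⁻ ω : Fin k → Ω, ENNReal.ofReal (sampleRange fun i => centredDistribution μ (U (ω i)))
      ∂(Measure.pi fun _ => P) = ∫⁻ t, ENNReal.ofReal (straddleProb k t) ∂μ := by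
  have hIco := measure_Ico_ne_top_of_lintegral_straddleProb hfin
  have hmono : MonotoneOn (centredDistribution μ) (Set.Ioo 0 1) := fun a ha b hb hab =>
    sub_nonneg.1 (by
      rw [centredDistribution_sub hIco ha.1 hab hb.2]
      exact measureReal_nonneg)
  have hall : ∀ᵐ ω : Fin k → Ω ∂(Measure.pi fun _ => P), ∀ i, U (ω i) ∈ Set.Ioo (0 : ℝ) 1 :=
    ae_all_iff.2 fun i => (measurePreserving_eval (fun _ : Fin k => P) i).quasiMeasurePreserving.ae
      hU01
  calc _ = ∫⁻ ω : Fin k → Ω, μ (Set.Ico (⨅ i, U (ω i)) (⨆ i, U (ω i)))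
        ∂(Measure.pi fun _ => P) := by
        refine lintegral_congr_ae (hall.mono fun ω hω => ?_)
        have : Nonempty (Fin k) := ⟨⟨0, hk⟩⟩
        obtain ⟨h1, h2, h3⟩ := sampleRange_comp_monotoneOn hmono hk hω
        simp only
        rw [h3, centredDistribution_sub hIco h1.1
          (ciInf_le_ciSup (Set.finite_range _).bddBelow (Set.finite_range _).bddAbove) h2.2,
          ofReal_measureReal (hIco _ _ h1.1 h2.2)]
    _ = _ := lintegral_pi_measure_Ico P hU μ hk
    _ = _ := lintegral_congr_ae (hμ.mono fun t ht => by simp only [hunif t ht])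

universe u

/-- `ULift` carries the unit interval to an arbitrary universe, as the main statement requires. -/
theorem exists_uniform : ∃ (Ω : Type u) (_ : MeasurableSpace Ω) (P : Measure Ω)
    (_ : IsProbabilityMeasure P) (U : Ω → ℝ), Measurable U ∧ (∀ᵐ ω ∂P, U ω ∈ Set.Ioo (0 : ℝ) 1) ∧
      ∀ t ∈ Set.Ioo (0 : ℝ) 1, P.real {ω | U ω ≤ t} = t := by
  have hp : IsProbabilityMeasure (volume.restrict (Set.Ioo (0 : ℝ) 1)) := ⟨by simp⟩
  refine ⟨ULift.{u} ℝ, inferInstance, (volume.restrict (Set.Ioo (0 : ℝ) 1)).map ULift.up,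
    Measure.isProbabilityMeasure_map measurable_up.aemeasurable, ULift.down, measurable_down,
    ?_, fun t ht => ?_⟩
  · refine (ae_map_iff (p := fun ω : ULift.{u} ℝ => ω.down ∈ Set.Ioo (0 : ℝ) 1)
      measurable_up.aemeasurable (measurable_down measurableSet_Ioo)).2 ?_
    exact ae_restrict_mem measurableSet_Ioo
  · rw [map_measureReal_apply measurable_up (measurableSet_le measurable_down measurable_const),
      measureReal_restrict_apply (by exact measurableSet_Iic)]
    have : (ULift.up ⁻¹' {ω : ULift.{u} ℝ | ω.down ≤ t}) ∩ Set.Ioo (0 : ℝ) 1 = Set.Ioc 0 t := by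
      ext x
      simp only [Set.mem_inter_iff, Set.mem_preimage, Set.mem_ofPred_eq, Set.mem_Ioo, Set.mem_Ioc]
      exact ⟨fun h => ⟨h.2.1, h.1⟩, fun h => ⟨h.2, h.1, h.2.trans_lt ht.2⟩⟩
    rw [this, Real.volume_real_Ioc_of_le ht.1.le, sub_zero]

theorem exists_expectedRanges_of_measure {ρ : ℕ → ℝ} {μ : Measure ℝ} [SFinite μ]
    (hμ : ∀ᵐ t ∂μ, t ∈ Set.Ioo (0 : ℝ) 1)
    (hρ : ∀ k, 1 ≤ k → 0 ≤ ρ k ∧ ∫⁻ t, ENNReal.ofReal (straddleProb k t) ∂μ = ENNReal.ofReal (ρ k))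
    (h2 : ρ 2 ≠ 0) :
    ∃ (Ω : Type u) (_ : MeasurableSpace Ω) (P : Measure Ω) (_ : IsProbabilityMeasure P)
        (X : Ω → ℝ), Measurable X ∧ Integrable X P ∧ IsNondegenerate P X ∧
        IsExpectedRangesSequenceOf P X ρ := by
  obtain ⟨Ω, m, P, hP, U, hU, hU01, hunif⟩ := exists_uniform.{u}
  have hfin : ∫⁻ t, ENNReal.ofReal (straddleProb 2 t) ∂μ ≠ ⊤ := by
    rw [(hρ 2 (by norm_num)).2]
    exact ENNReal.ofReal_ne_top
  have hX : Measurable fun ω => centredDistribution μ (U ω) :=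
    (measurable_centredDistribution μ).comp hU
  have hrange : ∀ k, 1 ≤ k → ∫⁻ ω : Fin k → Ω,
      ENNReal.ofReal (sampleRange fun i => centredDistribution μ (U (ω i)))
        ∂(Measure.pi fun _ => P) = ENNReal.ofReal (ρ k) := fun k hk => by
    rw [lintegral_sampleRange_centredDistribution P hU hU01 hunif hμ hfin hk, (hρ k hk).2]
  have hi : Integrable (fun ω => centredDistribution μ (U ω)) P := by
    rw [← lintegral_sampleRange_two_lt_top_iff P hX, hrange 2 (by norm_num)]
    exact ENNReal.ofReal_lt_top
  have hseq : IsExpectedRangesSequenceOf P (fun ω => centredDistribution μ (U ω)) ρ :=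
    fun k hk => by
      rw [expectedRange_eq_toReal P hX hk, hrange k hk, ENNReal.toReal_ofReal (hρ k hk).1]
  refine ⟨Ω, m, P, hP, _, hX, hi, ?_, hseq⟩
  rwa [← expectedRange_two_ne_zero P hX hi, hseq 2 (by norm_num)]

/-! ### Constructing the measure on levels from the three conditions -/

section Moments

open Polynomial

/-- The linear functional on polynomials sending `X ^ k` to `ρ k` for `k ≥ 1` and killing `1`. -/
noncomputable def rangeFunctional (ρ : ℕ → ℝ) : ℝ[X] →ₗ[ℝ] ℝ :=
  (Polynomial.basisMonomials ℝ).constr ℝ fun k => if k = 0 then 0 else ρ k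

theorem rangeFunctional_X_pow (ρ : ℕ → ℝ) (k : ℕ) :
    rangeFunctional ρ (X ^ k) = if k = 0 then 0 else ρ k := by
  rw [← monomial_one_right_eq_X_pow, rangeFunctional]
  have h := (basisMonomials ℝ).constr_basis ℝ (fun k => if k = 0 then 0 else ρ k) k
  rwa [coe_basisMonomials] at h

/-- Multiplication by `1 - X` acts on moments as the negative forward difference. -/
theorem rangeFunctional_pow_mul (ρ : ℕ → ℝ) {k : ℕ} (hk : 1 ≤ k) (s : ℕ) :
    rangeFunctional ρ (X ^ k * (1 - X) ^ s) = (-1) ^ s * (fwdDiff 1)^[s] ρ k := by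
  induction s generalizing k with
  | zero => simp [rangeFunctional_X_pow, Nat.one_le_iff_ne_zero.1 hk]
  | succ s ih =>
    rw [show (X ^ k * (1 - X) ^ (s + 1) : ℝ[X])
        = X ^ k * (1 - X) ^ s - X ^ (k + 1) * (1 - X) ^ s by ring, map_sub, ih hk,
      ih (by omega), Function.iterate_succ_apply', fwdDiff]
    ring

/-- Condition (iii) is the symmetry of the functional under `X ↦ 1 - X`; the sum starts at `j = 1`
because the functional kills `1`. -/
theorem rangeFunctional_one_sub_X_pow {ρ : ℕ → ℝ} {k : ℕ} (hk : 1 ≤ k)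
    (h : ρ k = ∑ j ∈ Finset.Icc 1 k, (-1 : ℝ) ^ j * (k.choose j : ℝ) * ρ j) :
    rangeFunctional ρ ((1 - X) ^ k) = ρ k := by
  have e : ((1 - X) ^ k : ℝ[X])
      = ∑ j ∈ Finset.range (k + 1), ((-1 : ℝ) ^ j * (k.choose j : ℝ)) • X ^ j := by
    rw [sub_eq_neg_add, add_pow]
    refine Finset.sum_congr rfl fun j _ => ?_
    rw [neg_pow (X : ℝ[X]), smul_eq_C_mul]
    simp
    ring
  rw [e, map_sum, Finset.range_eq_Ico, Finset.sum_eq_sum_Ico_succ_bot (by omega), h]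
  have e2 : Finset.Icc 1 k = Finset.Ico (0 + 1) (k + 1) := by ext; simp
  rw [e2, map_smul, rangeFunctional_X_pow, if_pos rfl, smul_zero, zero_add]
  refine Finset.sum_congr rfl fun j hj => ?_
  rw [map_smul, rangeFunctional_X_pow, if_neg (by simp at hj; omega), smul_eq_mul]

/-- The quotient of `1 - X ^ (m + 1) - (1 - X) ^ (m + 1)` by `X * (1 - X)`. -/
noncomputable def straddleQuotient (m : ℕ) : ℝ[X] :=
  ∑ j ∈ Finset.range m, (X ^ j + (1 - X) ^ j)

theorem X_mul_one_sub_X_mul_straddleQuotient (m : ℕ) :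
    X * (1 - X) * straddleQuotient m = 1 - X ^ (m + 1) - (1 - X) ^ (m + 1) := by
  induction m with
  | zero => simp [straddleQuotient]
  | succ m ih =>
    rw [straddleQuotient, Finset.sum_range_succ, mul_add, ← straddleQuotient, ih]
    ring

theorem straddleProb_eq_mul_eval (m : ℕ) (t : ℝ) :
    straddleProb (m + 1) t = t * (1 - t) * (straddleQuotient m).eval t := by
  have := congrArg (Polynomial.eval t) (X_mul_one_sub_X_mul_straddleQuotient m)
  simp at this
  rw [straddleProb, ← this]

theorem eval_straddleQuotient (m : ℕ) (t : ℝ) :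
    (straddleQuotient m).eval t = ∑ j ∈ Finset.range m, (t ^ j + (1 - t) ^ j) := by
  simp [straddleQuotient, eval_finsetSum]

theorem eval_straddleQuotient_nonneg (m : ℕ) {t : ℝ} (ht : t ∈ Set.Icc (0 : ℝ) 1) :
    0 ≤ (straddleQuotient m).eval t := by
  rw [eval_straddleQuotient]
  have h0 := ht.1
  have h1 := sub_nonneg.2 ht.2
  positivity

/-- Mass at an endpoint therefore contributes linearly in `m`, which condition (ii) forbids. -/
theorem le_eval_straddleQuotient (m : ℕ) {t : ℝ} (ht : t = 0 ∨ t = 1) :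
    (m : ℝ) ≤ (straddleQuotient m).eval t := by
  rw [eval_straddleQuotient]
  have : ∀ j ∈ Finset.range m, (1 : ℝ) ≤ t ^ j + (1 - t) ^ j := by
    intro j _
    rcases ht with rfl | rfl <;> simp
  simpa using Finset.sum_le_sum this

theorem exists_measure_integral_straddleQuotient {ρ : ℕ → ℝ}
    (h1 : ∀ s k : ℕ, 1 ≤ s → 1 ≤ k → 0 < (-1 : ℝ) ^ (s + 1) * (fwdDiff 1)^[s] ρ k)
    (h3 : ∀ k : ℕ, 1 ≤ k →
        ρ k = ∑ j ∈ Finset.Icc 1 k, (-1 : ℝ) ^ j * (k.choose j : ℝ) * ρ j) :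
    ∃ ν : Measure ℝ, IsFiniteMeasure ν ∧ (∀ᵐ t ∂ν, t ∈ Set.Icc (0 : ℝ) 1) ∧
      ∀ m : ℕ, ∫ t, (straddleQuotient m).eval t ∂ν = 2 * ρ (m + 1) := by
  -- The sign is chosen so that `L (X ^ a (1 - X) ^ b)` is `(-1) ^ (s + 1) Δ ^ s ρ k` with `s = b +
  -- 1`, `k = a + 1`. The factor `X (1 - X)` ensures `s, k ≥ 1`.
  let L : ℝ[X] →ₗ[ℝ] ℝ := -(rangeFunctional ρ ∘ₗ LinearMap.mulLeft ℝ (X * (1 - X)))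
  have hL : ∀ p, L p = -rangeFunctional ρ (X * (1 - X) * p) := fun p => rfl
  obtain ⟨ν, hν, h01, hint⟩ := exists_measure_integral_eq (L := L) fun a b => by
    have := h1 (b + 1) (a + 1) (by omega) (by omega)
    rw [hL, show (X * (1 - X) * (X ^ a * (1 - X) ^ b) : ℝ[X])
      = X ^ (a + 1) * (1 - X) ^ (b + 1) by ring, rangeFunctional_pow_mul ρ (by omega)]
    rw [pow_succ] at this
    linarith
  refine ⟨ν, hν, h01, fun m => ?_⟩
  have hone : rangeFunctional ρ 1 = 0 := by simpa using rangeFunctional_X_pow ρ 0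
  rw [hint, hL, X_mul_one_sub_X_mul_straddleQuotient, map_sub, map_sub, hone,
    rangeFunctional_one_sub_X_pow (by omega) (h3 (m + 1) (by omega)), rangeFunctional_X_pow,
    if_neg (by omega)]
  ring

theorem integrable_eval_of_ae_mem_Icc {ν : Measure ℝ} [IsFiniteMeasure ν]
    (h01 : ∀ᵐ t ∂ν, t ∈ Set.Icc (0 : ℝ) 1) (p : ℝ[X]) : Integrable (fun t => p.eval t) ν := by
  obtain ⟨C, hC⟩ := (isCompact_Icc (a := (0 : ℝ)) (b := 1)).exists_bound_of_continuousOn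
    p.continuous.continuousOn
  exact Integrable.of_bound p.continuous.aestronglyMeasurable C (h01.mono fun t ht => hC t ht)

theorem ae_mem_Ioo_of_integral_straddleQuotient {ρ : ℕ → ℝ} {ν : Measure ℝ} [IsFiniteMeasure ν]
    (h01 : ∀ᵐ t ∂ν, t ∈ Set.Icc (0 : ℝ) 1)
    (hint : ∀ m : ℕ, ∫ t, (straddleQuotient m).eval t ∂ν = 2 * ρ (m + 1))
    (ho : ρ =o[atTop] fun k : ℕ => (k : ℝ)) : ∀ᵐ t ∂ν, t ∈ Set.Ioo (0 : ℝ) 1 := by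
  have hE : MeasurableSet ({0, 1} : Set ℝ) := by measurability
  have hle : ∀ m : ℕ, m * ν.real {0, 1} ≤ 2 * ρ (m + 1) := by
    intro m
    have hi := integrable_eval_of_ae_mem_Icc h01 (straddleQuotient m)
    calc m * ν.real {0, 1} = ∫ t in ({0, 1} : Set ℝ), (m : ℝ) ∂ν := by simp [mul_comm]
      _ ≤ ∫ t in ({0, 1} : Set ℝ), (straddleQuotient m).eval t ∂ν :=
          setIntegral_mono_on (integrable_const _) hi.integrableOn hE
            fun t ht => le_eval_straddleQuotient m (by simpa using ht)
      _ ≤ ∫ t, (straddleQuotient m).eval t ∂ν :=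
          setIntegral_le_integral hi (h01.mono fun t ht => eval_straddleQuotient_nonneg m ht)
      _ = _ := hint m
  have hz : ν.real {0, 1} = 0 := by
    refine le_antisymm ?_ measureReal_nonneg
    by_contra! hpos
    -- At `m = N + 1` this gives `(N + 1) c ≤ 2 (c / 8) (N + 2)` with `c` the endpoint mass,
    -- impossible for `c > 0`.
    have h := ho.def (c := ν.real {0, 1} / 8) (by positivity)
    obtain ⟨N, hN⟩ := eventually_atTop.1 h
    have h4 := hN (N + 1 + 1) (by omega)
    have h5 := hle (N + 1)
    rw [Real.norm_eq_abs, Real.norm_eq_abs, abs_of_nonneg (Nat.cast_nonneg (α := ℝ) (N + 1 + 1))] at h4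
    have h6 := (le_abs_self _).trans h4
    push_cast at h5 h6
    have hN0 : (0 : ℝ) ≤ N := Nat.cast_nonneg N
    nlinarith [mul_nonneg hN0 hpos.le]
  have hz' : ν {0, 1} = 0 := (measureReal_eq_zero_iff (measure_ne_top _ _)).1 hz
  have hne : ∀ᵐ t ∂ν, t ∉ ({0, 1} : Set ℝ) := measure_eq_zero_iff_ae_notMem.1 hz'
  filter_upwards [h01, hne] with t ht ht'
  simp only [Set.mem_insert_iff, Set.mem_singleton_iff, not_or] at ht'
  exact ⟨lt_of_le_of_ne ht.1 (Ne.symm ht'.1), lt_of_le_of_ne ht.2 ht'.2⟩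

theorem exists_measure_lintegral_straddleProb {ρ : ℕ → ℝ}
    (h1 : ∀ s k : ℕ, 1 ≤ s → 1 ≤ k → 0 < (-1 : ℝ) ^ (s + 1) * (fwdDiff 1)^[s] ρ k)
    (h2 : ρ =o[atTop] fun k : ℕ => (k : ℝ))
    (h3 : ∀ k : ℕ, 1 ≤ k →
        ρ k = ∑ j ∈ Finset.Icc 1 k, (-1 : ℝ) ^ j * (k.choose j : ℝ) * ρ j) :
    ∃ μ : Measure ℝ, SFinite μ ∧ (∀ᵐ t ∂μ, t ∈ Set.Ioo (0 : ℝ) 1) ∧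
      ∀ k, 1 ≤ k → 0 ≤ ρ k ∧
        ∫⁻ t, ENNReal.ofReal (straddleProb k t) ∂μ = ENNReal.ofReal (ρ k) := by
  obtain ⟨ν, hν, h01, hint⟩ := exists_measure_integral_straddleQuotient h1 h3
  have hIoo := ae_mem_Ioo_of_integral_straddleQuotient h01 hint h2
  -- The factor `t (1 - t)` undoes the division in `straddleQuotient`, and `2` undoes the doubling
  -- in `2 * ρ (m + 1)`.
  let d : ℝ → ENNReal := fun t => ENNReal.ofReal (2 * (t * (1 - t)))⁻¹
  have hd : Measurable d := by fun_prop
  refine ⟨ν.withDensity d, inferInstance, (withDensity_absolutelyContinuous ν d).ae_le hIoo,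
    fun k hk => ?_⟩
  obtain ⟨m, rfl⟩ := Nat.exists_eq_add_of_le' hk
  have hnn : 0 ≤ᵐ[ν] fun t => (straddleQuotient m).eval t :=
    h01.mono fun t ht => eval_straddleQuotient_nonneg m ht
  refine ⟨?_, ?_⟩
  · have := integral_nonneg_of_ae hnn
    rw [hint m] at this
    linarith
  · rw [lintegral_withDensity_eq_lintegral_mul _ hd
      (continuous_straddleProb _).measurable.ennreal_ofReal]
    have hhalf : ρ (m + 1) = ∫ t, (straddleQuotient m).eval t / 2 ∂ν := by
      rw [integral_div, hint m]
      ring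
    rw [hhalf, ofReal_integral_eq_lintegral_ofReal
      ((integrable_eval_of_ae_mem_Icc h01 _).div_const 2)
      (hnn.mono fun t ht => div_nonneg ht (by norm_num))]
    refine lintegral_congr_ae (hIoo.mono fun t ht => ?_)
    have ht0 : t ≠ 0 := ht.1.ne'
    have ht1 : 1 - t ≠ 0 := (sub_pos.2 ht.2).ne'
    have hp : 0 ≤ (2 * (t * (1 - t)))⁻¹ := by
      have h0 := ht.1.le
      have h1 := (sub_pos.2 ht.2).le
      positivity
    simp only [Pi.mul_apply, d]
    rw [← ENNReal.ofReal_mul hp, straddleProb_eq_mul_eval]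
    congr 1
    field_simp

end Moments

/-! ### The characterisation -/

theorem theorem4p1 (ρ : ℕ → ℝ) :
    (∃ (Ω : Type*) (_ : MeasurableSpace Ω) (P : Measure Ω) (_ : IsProbabilityMeasure P)
        (X : Ω → ℝ), Measurable X ∧ Integrable X P ∧ IsNondegenerate P X ∧
        IsExpectedRangesSequenceOf P X ρ) ↔
      (∀ s k : ℕ, 1 ≤ s → 1 ≤ k → 0 < (-1 : ℝ) ^ (s + 1) * (fwdDiff 1)^[s] ρ k) ∧
      (ρ =o[atTop] fun k : ℕ => (k : ℝ)) ∧
      (∀ k : ℕ, 1 ≤ k →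
        ρ k = ∑ j ∈ Finset.Icc 1 k, (-1 : ℝ) ^ j * (k.choose j : ℝ) * ρ j) := by
  constructor
  · rintro ⟨Ω, _, P, _, X, hX, hi, hnd, hseq⟩
    have hG := measurable_measureReal_le P X
    have h01 : ∀ t, P.real {ω | X ω ≤ t} ∈ Set.Icc (0 : ℝ) 1 := fun t =>
      ⟨measureReal_nonneg, measureReal_le_one⟩
    have hint := straddleProb_integrable P hX hi
    have hρ : ∀ k, 1 ≤ k → ρ k = ∫ t, straddleProb k (P.real {ω | X ω ≤ t}) := fun k hk => by
      rw [← hseq k hk, expectedRange_eq_integral P hX hk]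
    have hρ2 : ρ 2 ≠ 0 := by
      rw [← hseq 2 (by norm_num)]
      exact (expectedRange_two_ne_zero P hX hi).2 hnd
    exact ⟨fun s k hs hk => fwdDiff_integral_straddleProb_pos hG h01 hint hρ hρ2 hs hk,
      integral_straddleProb_isLittleO hG h01 hint hρ,
      fun k hk => sum_integral_straddleProb hG h01 hint hρ hk⟩
  · rintro ⟨h1, h2, h3⟩
    obtain ⟨μ, _, hμ, hρ⟩ := exists_measure_lintegral_straddleProb h1 h2 h3
    refine exists_expectedRanges_of_measure hμ hρ ?_
    -- Condition (iii) at `k = 1` reads `ρ 1 = -ρ 1`, and (i) at `s = k = 1` reads `ρ 1 < ρ 2`; so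
    -- `ρ 2 > 0`.
    have hpos := h1 1 1 le_rfl le_rfl
    have hzero := h3 1 le_rfl
    simp [fwdDiff] at hpos hzero
    have : ρ 1 = 0 := by linarith
    linarith
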